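/- Notation. Let $\mathfrak H$ be the complex upper half-plane, $e(x)=\exp(2\pi i x)$, $q=e(\tau)$ and $\zeta=e(z)$ for $\tau\in\mathfrak H$, $z\in\mathbb C$. For a lattice $L=[\omega_1,\omega_2]=\mathbb Z\omega_1+\mathbb Z\omega_2\subset\mathbb C$ let $$\zeta(z,L)=\frac1z+\sum_{\omega\in L\setminus\{0\}}\Big(\frac1{z-\omega}+\frac1\omega+\frac z{\omega^2}\Big)$$ be the Weierstrass zeta function; for $\omega\in L$ let $\eta(\omega,L)$ be the constant with $\zeta(z+\omega,L)=\zeta(z,L)+\eta(\omega,L)$, and put $\eta(r_1\omega_1+r_2\omega_2,L)=r_1\eta(\omega_1,L)+r_2\eta(\omega_2,L)$ for $r_1,r_2\in\mathbb R$. Let $\psi(z,L)=-1$ if $z\in L\setminus 2L$ and $\psi(z,L)=1$ otherwise. Put $\rho(\tau,z)=\exp\big(\tfrac12\eta(1,[\tau,1])z^2-\pi i z\big)$. For $k\in\mathbb Z$, $\phi:\mathfrak H\times\mathbb C\to\mathbb C$, $M=\begin{pmatrix}a&b\\c&d\end{pmatrix}\in SL_2(\mathbb Z)$ and $(\lambda,\mu)\in\mathbb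 R^2$, with $\omega=\lambda\tau+\mu$, let $$(\phi|'_kM)(\tau,z)=(c\tau+d)^{-k}\phi\Big(\frac{a\tau+b}{c\tau+d},\frac z{c\tau+d}\Big),\qquad (\phi|''_k(\lambda,\mu))(\tau,z)=\Big(\psi(\omega,[\tau,1])\exp\big(\eta(\omega,[\tau,1])(z+\tfrac12\omega)\big)\Big)^k\phi(\tau,z+\omega).$$ Let $J_k=J_k(SL_2(\mathbb Z))$ be the complex vector space of holomorphic functions $\phi:\mathfrak H\times\mathbb C\to\mathbb C$ such that (i) $\phi|'_kM=\phi$ for all $M\in SL_2(\mathbb Z)$, (ii) $\phi|''_kX=\phi$ for all $X\in\mathbb Z^2$, and (iii) for each $M\in SL_2(\mathbb Z)$ the function $\rho^k(\phi|'_kM)$ has a Fourier development $$\sum_{n\ge0}\ \sum_{|r|\le r_0(n)}c(n,r)q^n\zeta^r \qquad(*)$$ for some (weakly) increasing sequence $(r_0(n))_{n\ge0}$ of nonnegative integers with $r_0(n)/n\to0$ as $n\to\infty$. For an integer $m>0$ let $J_k^m\subset J_k$ be the subspace consisting of $0$ and of all $\phi\in J_k$ for which $\rho^k\phi$ has a Fourier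 development $(*)$, with a sequence $r_0$ as in (iii), such that $$\min\{n-r_0(n):n\ge0\}+\frac k8\ge-m.$$ Theorem. Let $k<0$ and $m>0$ be integers. Then $J_k^m$ is a finite-dimensional complex vector space. -/

import Mathlib

noncomputable section

namespace ModifiedJacobi

open Filter Topology UpperHalfPlane
open scoped MatrixGroups

/-! ### The Weierstrass zeta function and the quasi-period map of a lattice -/

/-- The Weierstrass zeta function
`1 / z + ∑_{l ∈ L, l ≠ 0} (1 / (z - l) + 1 / l + z / l ^ 2)` of a lattice `L`. Since `1 / 0 = 0`,
the term of index `l = 0` of the sum below is `1 / z`. -/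
def weierstrassZeta (L : PeriodPair) (z : ℂ) : ℂ :=
  ∑' l : L.lattice, (1 / (z - l) + 1 / (l : ℂ) + z / (l : ℂ) ^ 2)

lemma weierstrassZeta_bound (r : ℝ) (hr : 0 < r) (s : ℂ) (hs : ‖s‖ < r) (l : ℂ)
    (h : 2 * r ≤ ‖l‖) :
    ‖1 / (s - l) + 1 / l + s / l ^ 2‖ ≤ 2 * r ^ 2 * ‖l‖ ^ (-3 : ℝ) := by
  have hl : 0 < ‖l‖ := by linarith
  have hl0 : l ≠ 0 := norm_pos_iff.mp hl
  have hsl : s - l ≠ 0 := by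
    intro e
    obtain rfl := sub_eq_zero.mp e
    linarith
  have hlow : ‖l‖ / 2 ≤ ‖s - l‖ := by
    rw [norm_sub_rev]
    exact le_trans (by linarith) (norm_sub_norm_le l s)
  have e : 1 / (s - l) + 1 / l + s / l ^ 2 = s ^ 2 / ((s - l) * l ^ 2) := by
    field_simp
    ring
  rw [e, norm_div, norm_mul, norm_pow, norm_pow]
  calc ‖s‖ ^ 2 / (‖s - l‖ * ‖l‖ ^ 2) ≤ r ^ 2 / (‖l‖ / 2 * ‖l‖ ^ 2) := by gcongr
    _ = 2 * r ^ 2 / ‖l‖ ^ 3 := by field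
    _ = _ := by norm_cast

lemma hasSumLocallyUniformly_weierstrassZeta (L : PeriodPair) :
    HasSumLocallyUniformly
      (fun (l : L.lattice) (z : ℂ) ↦ 1 / (z - l) + 1 / (l : ℂ) + z / (l : ℂ) ^ 2)
      (weierstrassZeta L) := by
  refine L.hasSumLocallyUniformly_aux (u := fun r l ↦ 2 * r ^ 2 * ‖l‖ ^ (-3 : ℝ)) _
    (fun _ _ ↦ (ZLattice.summable_norm_rpow _ _ (by simp; norm_num)).mul_left _) fun r hr ↦
    Filter.eventually_atTop.mpr ⟨2 * r, ?_⟩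
  rintro _ h s hs l rfl
  exact weierstrassZeta_bound r hr s hs l h

lemma differentiableOn_weierstrassZeta (L : PeriodPair) :
    DifferentiableOn ℂ (weierstrassZeta L) (L.lattice : Set ℂ)ᶜ := by
  refine (hasSumLocallyUniformly_weierstrassZeta L).hasSumLocallyUniformlyOn.differentiableOn
    (.of_forall fun s ↦ .fun_sum fun i _ ↦ ?_) L.isClosed_lattice.isOpen_compl
  intro x hx
  have : x - i ≠ 0 := fun e ↦ hx (by rw [sub_eq_zero.mp e]; exact i.2)
  refine DifferentiableAt.differentiableWithinAt ?_
  fun_prop (disch := assumption)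

lemma deriv_weierstrassZeta (L : PeriodPair) :
    Set.EqOn (deriv (weierstrassZeta L)) (fun z ↦ -L.weierstrassP z) (L.lattice : Set ℂ)ᶜ := by
  have hne : ∀ x ∈ (L.lattice : Set ℂ)ᶜ, ∀ i : L.lattice, x - i ≠ 0 := fun x hx i e ↦
    hx (by rw [sub_eq_zero.mp e]; exact i.2)
  have hd : ∀ (i : L.lattice), ∀ x ∈ (L.lattice : Set ℂ)ᶜ,
      HasDerivAt (fun z : ℂ ↦ 1 / (z - i) + 1 / (i : ℂ) + z / (i : ℂ) ^ 2)
        (-(1 / (x - i) ^ 2 - 1 / (i : ℂ) ^ 2)) x := by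
    intro i x hx
    have h1 : HasDerivAt (fun z : ℂ ↦ 1 / (z - i)) (-1 / (x - i) ^ 2) x := by
      simpa using ((hasDerivAt_id x).sub_const (i : ℂ)).fun_inv (hne x hx i)
    have h2 : HasDerivAt (fun z : ℂ ↦ z / (i : ℂ) ^ 2) (1 / (i : ℂ) ^ 2) x :=
      (hasDerivAt_id x).div_const _
    exact ((h1.add_const _).add h2).congr_deriv (by ring)
  refine ((hasSumLocallyUniformly_weierstrassZeta L).tendstoLocallyUniformlyOn.deriv
    (.of_forall fun s ↦ ?_) L.isClosed_lattice.isOpen_compl).unique ?_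
  · exact .fun_sum fun i _ x hx ↦ (hd i x hx).differentiableAt.differentiableWithinAt
  · have h := L.hasSumLocallyUniformly_weierstrassP.tendstoLocallyUniformlyOn
      (s := (L.lattice : Set ℂ)ᶜ)
    have h' := uniformContinuous_neg (α := ℂ) |>.comp_tendstoLocallyUniformlyOn h
    refine h'.congr ?_
    intro s x hx
    simp only [Function.comp_apply]
    rw [deriv_fun_sum fun i _ ↦ (hd i x hx).differentiableAt, ← Finset.sum_neg_distrib]
    exact Finset.sum_congr rfl fun i _ ↦ ((hd i x hx).deriv).symm

/-- For a lattice point `l` the difference `ζ(z + l) - ζ(z)` does not depend on `z ∉ L`. -/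
theorem exists_quasiPeriod (L : PeriodPair) (l : L.lattice) :
    ∃ c : ℂ, ∀ z ∉ L.lattice, weierstrassZeta L (z + l) = weierstrassZeta L z + c := by
  have hopen : IsOpen (L.lattice : Set ℂ)ᶜ := L.isClosed_lattice.isOpen_compl
  have hadd : ∀ z ∈ (L.lattice : Set ℂ)ᶜ, z + l ∈ (L.lattice : Set ℂ)ᶜ := fun z hz h ↦
    hz (by simpa using L.lattice.sub_mem h l.2)
  have hdz : ∀ z ∈ (L.lattice : Set ℂ)ᶜ,
      HasDerivAt (weierstrassZeta L) (-L.weierstrassP z) z := fun z hz ↦ by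
    have := ((differentiableOn_weierstrassZeta L).differentiableAt
      (hopen.mem_nhds hz)).hasDerivAt
    rwa [deriv_weierstrassZeta L hz] at this
  have hD : ∀ z ∈ (L.lattice : Set ℂ)ᶜ,
      HasDerivAt (fun z ↦ weierstrassZeta L (z + l) - weierstrassZeta L z) 0 z := fun z hz ↦ by
    refine (((hdz _ (hadd z hz)).comp_add_const z l).sub (hdz z hz)).congr_deriv ?_
    simp
  have hcount : (L.lattice : Set ℂ).Countable :=
    Set.countable_coe_iff.mp (L.latticeEquivProd.toEquiv.countable_iff.mpr inferInstance)
  have hconn := hcount.isConnected_compl_of_one_lt_rank (by simp [Complex.rank_real_complex])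
  obtain ⟨c, hc⟩ := hopen.exists_is_const_of_deriv_eq_zero hconn.isPreconnected
    (fun z hz ↦ (hD z hz).differentiableAt.differentiableWithinAt) (fun z hz ↦ (hD z hz).deriv)
  exact ⟨c, fun z hz ↦ by linear_combination hc z hz⟩

/-- The quasi-period `η(l, L)` of a lattice point `l`. -/
def quasiPeriod (L : PeriodPair) (l : L.lattice) : ℂ := (exists_quasiPeriod L l).choose

/-- The Weierstrass eta function `η(z, L)`, the `ℝ`-linear extension of the quasi-periods. -/
def weierstrassEta (L : PeriodPair) (z : ℂ) : ℂ :=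
  (L.basis.repr z 0 : ℂ) * quasiPeriod L ⟨L.ω₁, L.ω₁_mem_lattice⟩ +
    (L.basis.repr z 1 : ℂ) * quasiPeriod L ⟨L.ω₂, L.ω₂_mem_lattice⟩

open Classical in
/-- `ψ(z, L)` is `-1` if `z ∈ L - 2L` and `1` otherwise. -/
def psi (L : PeriodPair) (z : ℂ) : ℂ :=
  if z ∈ L.lattice ∧ ¬ ∃ l ∈ L.lattice, z = 2 * l then -1 else 1

/-- The lattice `[τ, 1]`. -/
def tauLattice (τ : ℍ) : PeriodPair where
  ω₁ := τ
  ω₂ := 1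
  indep := by
    rw [LinearIndependent.pair_iff]
    intro s t h
    have him := congrArg Complex.im h
    have hs : s = 0 := by simpa [τ.im_ne_zero] using him
    have hre := congrArg Complex.re h
    exact ⟨hs, by simpa [hs] using hre⟩

/-! ### Slash operators -/

/-- `(φ |'_k M)(τ, z) = (c τ + d) ^ (-k) φ ((a τ + b) / (c τ + d), z / (c τ + d))`. -/
def slashM (k : ℤ) (M : SL(2, ℤ)) (φ : ℍ × ℂ → ℂ) : ℍ × ℂ → ℂ := fun p ↦
  ((M 1 0 : ℂ) * p.1 + (M 1 1 : ℂ)) ^ (-k) *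
    φ (M • p.1, p.2 / ((M 1 0 : ℂ) * p.1 + (M 1 1 : ℂ)))

/-- `(φ |''_k (lam, mu))(τ, z) = (ψ(ω) exp (η(ω) (z + ω / 2))) ^ k φ (τ, z + ω)`, where
`ω = lam τ + mu` and `ψ`, `η` are those of the lattice `[τ, 1]`. -/
def slashX (k : ℤ) (lam mu : ℝ) (φ : ℍ × ℂ → ℂ) : ℍ × ℂ → ℂ := fun p ↦
  (psi (tauLattice p.1) (lam * p.1 + mu) *
    Complex.exp (weierstrassEta (tauLattice p.1) (lam * p.1 + mu) *
      (p.2 + (lam * p.1 + mu) / 2))) ^ k *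
    φ (p.1, p.2 + (lam * p.1 + mu))

/-- `ρ(τ, z) = exp (η(1, [τ, 1]) z ^ 2 / 2 - π i z)`. -/
def rho (p : ℍ × ℂ) : ℂ :=
  Complex.exp (weierstrassEta (tauLattice p.1) 1 * p.2 ^ 2 / 2 - Real.pi * Complex.I * p.2)

/-! ### Fourier developments -/

/-- `f` has a Fourier development `∑_{n ≥ 0} ∑_{|r| ≤ r₀(n)} c(n, r) q ^ n ζ ^ r`, where
`q = e(τ)` and `ζ = e(z)`. -/
def HasFourierDevelopment (f : ℍ × ℂ → ℂ) (r₀ : ℕ → ℕ) : Prop :=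
  ∃ c : ℕ → ℤ → ℂ, (∀ n r, (r₀ n : ℤ) < |r| → c n r = 0) ∧
    ∀ (τ : ℍ) (z : ℂ),
      HasSum (fun p : ℕ × ℤ ↦ c p.1 p.2 * Complex.exp (2 * Real.pi * Complex.I * τ) ^ p.1 *
        Complex.exp (2 * Real.pi * Complex.I * z) ^ p.2) (f (τ, z))

/-- An increasing sequence `r₀` of nonnegative integers with `r₀(n) / n → 0`. -/
def IsSlow (r₀ : ℕ → ℕ) : Prop :=
  Monotone r₀ ∧ Tendsto (fun n : ℕ ↦ (r₀ n : ℝ) / n) atTop (𝓝 0)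

lemma IsSlow.zero : IsSlow (fun _ ↦ 0) := ⟨monotone_const, by simp⟩

lemma IsSlow.max {r s : ℕ → ℕ} (hr : IsSlow r) (hs : IsSlow s) :
    IsSlow (fun n ↦ Max.max (r n) (s n)) := by
  refine ⟨hr.1.max hs.1, ?_⟩
  have := hr.2.max hs.2
  rw [max_self] at this
  refine this.congr fun n ↦ ?_
  rw [Nat.cast_max, max_div_div_right (Nat.cast_nonneg n)]

lemma HasFourierDevelopment.zero (r₀ : ℕ → ℕ) : HasFourierDevelopment 0 r₀ :=
  ⟨0, by simp, fun τ z ↦ by simp⟩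

lemma HasFourierDevelopment.add {f g : ℍ × ℂ → ℂ} {r s : ℕ → ℕ}
    (hf : HasFourierDevelopment f r) (hg : HasFourierDevelopment g s) :
    HasFourierDevelopment (f + g) (fun n ↦ Max.max (r n) (s n)) := by
  obtain ⟨c, hc, hc'⟩ := hf
  obtain ⟨d, hd, hd'⟩ := hg
  refine ⟨c + d, fun n t h ↦ ?_, fun τ z ↦ ?_⟩
  · rw [Nat.cast_max, max_lt_iff] at h
    simp [hc n t h.1, hd n t h.2]
  · simpa [add_mul] using (hc' τ z).add (hd' τ z)

lemma HasFourierDevelopment.smul {f : ℍ × ℂ → ℂ} {r : ℕ → ℕ} (a : ℂ)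
    (hf : HasFourierDevelopment f r) : HasFourierDevelopment (a • f) r := by
  obtain ⟨c, hc, hc'⟩ := hf
  refine ⟨a • c, fun n t h ↦ by simp [hc n t h], fun τ z ↦ ?_⟩
  simpa [mul_assoc] using (hc' τ z).mul_left a

lemma slashM_zero (k : ℤ) (M : SL(2, ℤ)) : slashM k M 0 = 0 := by
  ext; simp [slashM]

lemma slashM_add (k : ℤ) (M : SL(2, ℤ)) (f g : ℍ × ℂ → ℂ) :
    slashM k M (f + g) = slashM k M f + slashM k M g := by
  ext; simp [slashM, mul_add]

lemma slashM_smul (k : ℤ) (M : SL(2, ℤ)) (a : ℂ) (f : ℍ × ℂ → ℂ) :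
    slashM k M (a • f) = a • slashM k M f := by
  ext; simp [slashM, mul_left_comm]

lemma slashX_zero (k : ℤ) (lam mu : ℝ) : slashX k lam mu 0 = 0 := by
  ext; simp [slashX]

lemma slashX_add (k : ℤ) (lam mu : ℝ) (f g : ℍ × ℂ → ℂ) :
    slashX k lam mu (f + g) = slashX k lam mu f + slashX k lam mu g := by
  ext; simp [slashX, mul_add]

lemma slashX_smul (k : ℤ) (lam mu : ℝ) (a : ℂ) (f : ℍ × ℂ → ℂ) :
    slashX k lam mu (a • f) = a • slashX k lam mu f := by
  ext; simp [slashX, mul_left_comm]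

/-! ### Modified Jacobi forms of index zero -/

/-- Holomorphy of a function on `ℍ × ℂ`. -/
def IsHolomorphic (φ : ℍ × ℂ → ℂ) : Prop :=
  DifferentiableOn ℂ (fun p : ℂ × ℂ ↦ φ (ofComplex p.1, p.2)) {p | 0 < p.1.im}

/-- A modified Jacobi form of weight `k` and index `0` on `Γ`. -/
structure IsModifiedJacobiForm (k : ℤ) (Γ : Subgroup SL(2, ℤ)) (φ : ℍ × ℂ → ℂ) : Prop where
  holomorphic : IsHolomorphic φ
  slashM_eq : ∀ M ∈ Γ, slashM k M φ = φ
  slashX_eq : ∀ lam mu : ℤ, slashX k lam mu φ = φ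
  fourier : ∀ M : SL(2, ℤ), ∃ r₀ : ℕ → ℕ, IsSlow r₀ ∧
    HasFourierDevelopment (fun p ↦ rho p ^ k * slashM k M φ p) r₀

/-- The complex vector space `J_k(Γ)`. -/
def J (k : ℤ) (Γ : Subgroup SL(2, ℤ)) : Submodule ℂ (ℍ × ℂ → ℂ) where
  carrier := {φ | IsModifiedJacobiForm k Γ φ}
  zero_mem' := by
    refine ⟨differentiableOn_const 0, fun M _ ↦ slashM_zero k M, fun _ _ ↦ slashX_zero k _ _,
      fun M ↦ ⟨_, IsSlow.zero, ?_⟩⟩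
    convert! HasFourierDevelopment.zero _ using 1
    ext; simp [slashM_zero]
  add_mem' := by
    intro f g hf hg
    refine ⟨hf.1.add hg.1, fun M hM ↦ ?_, fun l m ↦ ?_, fun M ↦ ?_⟩
    · rw [slashM_add, hf.2 M hM, hg.2 M hM]
    · rw [slashX_add, hf.3, hg.3]
    · obtain ⟨r, hr, hr'⟩ := hf.4 M
      obtain ⟨s, hs, hs'⟩ := hg.4 M
      refine ⟨_, hr.max hs, ?_⟩
      convert! hr'.add hs' using 1
      ext; simp [slashM_add, mul_add]
  smul_mem' := by
    intro a f hf
    refine ⟨hf.1.const_smul a, fun M hM ↦ ?_, fun l m ↦ ?_, fun M ↦ ?_⟩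
    · rw [slashM_smul, hf.2 M hM]
    · rw [slashX_smul, hf.3]
    · obtain ⟨r, hr, hr'⟩ := hf.4 M
      refine ⟨r, hr, ?_⟩
      convert! hr'.smul a using 1
      ext; simp [slashM_smul, mul_left_comm]

/-- `ρ ^ k φ` has a Fourier development as in the definition of a modified Jacobi form, with
`min {n - r₀(n) : n ≥ 0} + k / 8 ≥ -m`. -/
def HasBoundedFourier (k m : ℤ) (φ : ℍ × ℂ → ℂ) : Prop :=
  ∃ r₀ : ℕ → ℕ, IsSlow r₀ ∧ HasFourierDevelopment (fun p ↦ rho p ^ k * φ p) r₀ ∧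
    ∃ μ : ℤ, IsLeast (Set.range fun n : ℕ ↦ (n : ℤ) - (r₀ n : ℤ)) μ ∧
      -(m : ℝ) ≤ (μ : ℝ) + (k : ℝ) / 8

lemma HasBoundedFourier.add {k m : ℤ} {f g : ℍ × ℂ → ℂ} (hf : HasBoundedFourier k m f)
    (hg : HasBoundedFourier k m g) : HasBoundedFourier k m (f + g) := by
  obtain ⟨r, hr, hfr, μ, ⟨⟨a, ha⟩, hμ⟩, hμm⟩ := hf
  obtain ⟨s, hs, hgs, ν, ⟨⟨b, hb⟩, hν⟩, hνm⟩ := hg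
  have h1 : ∀ n : ℕ, μ ≤ (n : ℤ) - r n := fun n ↦ hμ ⟨n, rfl⟩
  have h2 : ∀ n : ℕ, ν ≤ (n : ℤ) - s n := fun n ↦ hν ⟨n, rfl⟩
  refine ⟨_, hr.max hs, ?_, min μ ν, ⟨?_, ?_⟩, ?_⟩
  · convert! hfr.add hgs using 1
    ext; simp [mul_add]
  · rcases le_total μ ν with h | h
    · refine ⟨a, ?_⟩
      have := h2 a
      simp only at ha ⊢
      omega
    · refine ⟨b, ?_⟩
      have := h1 b
      simp only at hb ⊢
      omega
  · rintro _ ⟨n, rfl⟩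
    have := h1 n
    have := h2 n
    simp only
    omega
  · rcases min_choice μ ν with h | h <;> rw [h] <;> assumption

lemma HasBoundedFourier.smul {k m : ℤ} {f : ℍ × ℂ → ℂ} (a : ℂ)
    (hf : HasBoundedFourier k m f) : HasBoundedFourier k m (a • f) := by
  obtain ⟨r, hr, hfr, hμ⟩ := hf
  refine ⟨r, hr, ?_, hμ⟩
  convert! hfr.smul a using 1
  ext; simp [mul_left_comm]

/-- The subspace `J_k^m` of `J_k(SL₂(ℤ))`. The zero form is included by convention: since
`n - r₀(n) ≤ 0` for `n = 0`, no form at all satisfies the inequality when `k < -8 m`, and when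
`-8 m ≤ k` the zero form satisfies it with `r₀ = 0`. -/
def Jm (k m : ℤ) : Submodule ℂ (ℍ × ℂ → ℂ) where
  carrier := {φ | φ ∈ J k ⊤ ∧ (φ = 0 ∨ HasBoundedFourier k m φ)}
  zero_mem' := ⟨(J k ⊤).zero_mem, Or.inl rfl⟩
  add_mem' := by
    rintro f g ⟨hf, hf'⟩ ⟨hg, hg'⟩
    refine ⟨(J k ⊤).add_mem hf hg, ?_⟩
    rcases hf' with rfl | hf'
    · simpa using hg'
    · rcases hg' with rfl | hg'
      · right
        simpa using hf'
      · exact Or.inr (hf'.add hg')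
  smul_mem' := by
    rintro a f ⟨hf, hf'⟩
    refine ⟨(J k ⊤).smul_mem a hf, ?_⟩
    rcases hf' with rfl | hf'
    · left
      simp
    · exact Or.inr (hf'.smul a)

end ModifiedJacobi

end

noncomputable section

namespace ModifiedJacobi

open Filter Topology UpperHalfPlane
open scoped MatrixGroups Manifold ModularForm

/-! ### The Legendre relation -/

/-! Write `k = -N`. Already the whole space `J_k` has dimension at most one, and `J_k^m` is a
subspace of it (`J_le_span_singleton`).

Let `h = ρ^k φ`, with Fourier coefficients `c(n, r)`. Its Taylor coefficients in `z` at `0` are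
power series in `q`. Since `ρ(τ, 0) = 1`, the first one that does not vanish is also that of `φ`,
hence a level one modular form of weight `k + J`, where `J` is its index. There are none of negative
weight and only constants in weight zero, so the coefficients of index below `N` vanish and the one
of index `N` is a constant `b`.

If `b = 0`, then `φ = 0`. By the Legendre relation, `z ↦ z + τ` multiplies `h` by `(-ζ)^k`, which
reads `c(n + r, r + N) = ± c(n, r)`. As `c` vanishes for `n < 0`, induction on `n` confines row `n`
to `0 ≤ r ≤ N`; the `N + 1` vanishing Taylor coefficients then form a Vandermonde system that kills
the row (`coeff_eq_zero_of_moment_eq_zero`). So `φ ↦ b` is injective. -/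

lemma hasSum_inv_sub_sub_inv_sub {w w' : ℂ} (hw : w ∈ Complex.integerComplement)
    (hw' : w' ∈ Complex.integerComplement)
    (hs : Summable fun m : ℤ ↦ 1 / (w' - m) - 1 / (w - m)) :
    HasSum (fun m : ℤ ↦ 1 / (w' - m) - 1 / (w - m))
      (Real.pi * Complex.cot (Real.pi * w') - Real.pi * Complex.cot (Real.pi * w)) := by
  have key : ∀ x ∈ Complex.integerComplement,
      HasSum (fun n : ℕ ↦ 1 / (x - n) + 1 / (x + n))
        (Real.pi * Complex.cot (Real.pi * x) + 1 / x) := fun x hx ↦ by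
    have h : HasSum (fun n : ℕ ↦ 1 / (x - (n + 1)) + 1 / (x + (n + 1)))
        (Real.pi * Complex.cot (Real.pi * x) - 1 / x) := by
      rw [cot_series_rep' hx]
      exact (summable_cotTerm hx).hasSum
    -- Including `n = 0` adds `2 / x`, which turns `-1 / x` into `+1 / x`. Pairing `±n` again counts
    -- the zero term twice, and this excess cancels at the end.
    have h' := (hasSum_nat_add_iff (f := fun n : ℕ ↦ 1 / (x - n) + 1 / (x + n)) 1).mp
      (by simpa using h)
    convert! h' using 1
    simp
  have h1 := (key w' hw').sub (key w hw)
  have h2 := hs.hasSum.nat_add_neg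
  have h3 : (fun n : ℕ ↦ 1 / (w' - n) + 1 / (w' + n) - (1 / (w - n) + 1 / (w + n))) =
      fun n : ℕ ↦ (1 / (w' - ((n : ℤ) : ℂ)) - 1 / (w - ((n : ℤ) : ℂ))) +
        (1 / (w' - ((-(n : ℤ) : ℤ) : ℂ)) - 1 / (w - ((-(n : ℤ) : ℤ) : ℂ))) := by
    ext n
    push_cast
    simp only [sub_neg_eq_add]
    ring
  rw [h3] at h1
  have h4 := h1.unique h2
  have h5 := hs.hasSum
  convert! h5 using 1
  simp only [Int.cast_zero, sub_zero] at h4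
  linear_combination h4

lemma tendsto_cot_atTop (τ : ℍ) (a : ℂ) :
    Tendsto (fun n : ℕ ↦ Complex.cot (Real.pi * ((n + a) * τ))) atTop (𝓝 (-Complex.I)) := by
  have h : Tendsto (fun n : ℕ ↦ Complex.exp (2 * Real.pi * Complex.I * ((n + a) * τ))) atTop
      (𝓝 0) := by
    have h0 := (tendsto_pow_atTop_nhds_zero_of_norm_lt_one
      (UpperHalfPlane.norm_exp_two_pi_I_lt_one τ)).const_mul
      (Complex.exp (2 * Real.pi * Complex.I * (a * τ)))
    rw [mul_zero] at h0
    refine h0.congr fun n ↦ ?_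
    rw [← Complex.exp_nat_mul, ← Complex.exp_add]
    congr 1
    ring
  simp_rw [Complex.cot_pi_eq_exp_ratio]
  have h1 := (h.add_const 1).div ((h.const_sub 1).const_mul Complex.I) (by simp)
  simpa [Pi.div_def] using h1

lemma integerComplement_of_im_ne_zero {w : ℂ} (hw : w.im ≠ 0) :
    w ∈ Complex.integerComplement := by
  rintro ⟨n, rfl⟩
  simp at hw

/-- Subtract the series of `ζ(z)` from that of `ζ(z + l)`: the terms independent of `z` cancel. -/
lemma hasSum_quasiPeriod (τ : ℍ) (l : (tauLattice τ).lattice) (z : ℂ)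
    (hz : z ∉ (tauLattice τ).lattice) :
    HasSum (fun p : ℤ × ℤ ↦ (1 / (z + l - p.1 * τ - p.2) - 1 / (z - p.1 * τ - p.2)) +
      (l : ℂ) / (p.1 * τ + p.2) ^ 2) (quasiPeriod (tauLattice τ) l) := by
  have hs := (hasSumLocallyUniformly_weierstrassZeta (tauLattice τ))
  have h1 := (hs.hasSum (x := z + l)).sub (hs.hasSum (x := z))
  rw [(exists_quasiPeriod (tauLattice τ) l).choose_spec z hz, add_sub_cancel_left] at h1
  have h2 := ((tauLattice τ).latticeEquivProd.symm.toEquiv.hasSum_iff).mpr h1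
  refine h2.congr_fun fun p ↦ ?_
  have e : (((tauLattice τ).latticeEquivProd.symm p : (tauLattice τ).lattice) : ℂ) =
      p.1 * τ + p.2 := by
    rw [PeriodPair.latticeEquiv_symm_apply]
    simp [tauLattice]
  simp only [Function.comp_apply, LinearEquiv.coe_toEquiv, e]
  rw [sub_sub, sub_sub]
  ring

/-- Sum over `m` first: each row is a difference of two cotangents plus a row of an Eisenstein
series. The conditions on imaginary parts keep every row away from the poles. -/
lemma hasSum_row (τ : ℍ) (l : (tauLattice τ).lattice) (z : ℂ)
    (hz : ∀ n : ℤ, (z - n * τ).im ≠ 0) (hzl : ∀ n : ℤ, (z + l - n * τ).im ≠ 0) :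
    HasSum (fun n : ℤ ↦ (Real.pi * Complex.cot (Real.pi * (z + l - n * τ)) -
        Real.pi * Complex.cot (Real.pi * (z - n * τ))) +
      l * ∑' m : ℤ, 1 / ((n : ℂ) * τ + m) ^ 2) (quasiPeriod (tauLattice τ) l) := by
  have hmem : z ∉ (tauLattice τ).lattice := fun h ↦ by
    obtain ⟨a, b, e⟩ := PeriodPair.mem_lattice.mp h
    refine hz a ?_
    rw [← e]
    simp [tauLattice]
  have h := hasSum_quasiPeriod τ l z hmem
  refine h.prod_fiberwise fun n ↦ ?_
  have hsq : HasSum (fun m : ℤ ↦ (l : ℂ) / ((n : ℂ) * τ + m) ^ 2)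
      (l * ∑' m : ℤ, 1 / ((n : ℂ) * τ + m) ^ 2) := by
    have h0 : Summable fun m : ℤ ↦ 1 / ((n : ℂ) * τ + m) ^ 2 :=
      (EisensteinSeries.linear_right_summable (τ : ℂ) n (k := 2) le_rfl).congr fun m ↦ by
        simp [zpow_ofNat]
    refine (h0.hasSum.mul_left (l : ℂ)).congr_fun fun m ↦ ?_
    ring
  have hsum := (h.summable.prod_factor n).sub hsq.summable
  simp only [add_sub_cancel_right] at hsum
  exact (hasSum_inv_sub_sub_inv_sub (integerComplement_of_im_ne_zero (hz n))
    (integerComplement_of_im_ne_zero (hzl n)) hsum).add hsq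

lemma half_sub_int_ne_zero (n : ℤ) : (1 / 2 - n : ℝ) ≠ 0 := by
  intro h
  have h1 : (1 : ℝ) = 2 * n := by linarith
  have h2 : (1 : ℤ) = 2 * n := by exact_mod_cast h1
  omega

/-- The Legendre relation for the lattice `[τ, 1]`. -/
theorem legendre_relation (τ : ℍ) :
    quasiPeriod (tauLattice τ) ⟨(tauLattice τ).ω₁, (tauLattice τ).ω₁_mem_lattice⟩ =
      τ * quasiPeriod (tauLattice τ) ⟨(tauLattice τ).ω₂, (tauLattice τ).ω₂_mem_lattice⟩ -
        2 * Real.pi * Complex.I := by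
  -- The base point `τ / 2` lies halfway between two lattice rows, and so do its translates by `1`
  -- and `τ`.
  have him : ∀ n : ℤ, ((τ : ℂ) / 2 - n * τ).im ≠ 0 := fun n ↦ by
    have : ((τ : ℂ) / 2 - n * τ).im = (1 / 2 - n) * τ.im := by simp; ring
    rw [this]
    exact mul_ne_zero (half_sub_int_ne_zero n) τ.im_ne_zero
  have h1 := hasSum_row τ ⟨(tauLattice τ).ω₂, (tauLattice τ).ω₂_mem_lattice⟩ (τ / 2) him
    fun n ↦ by simpa [tauLattice] using him n
  have h2 := hasSum_row τ ⟨(tauLattice τ).ω₁, (tauLattice τ).ω₁_mem_lattice⟩ (τ / 2) him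
    fun n ↦ by
      convert him (n - 1) using 2
      simp [tauLattice]
      ring
  set η₂ := quasiPeriod (tauLattice τ) ⟨(tauLattice τ).ω₂, (tauLattice τ).ω₂_mem_lattice⟩
  set η₁ := quasiPeriod (tauLattice τ) ⟨(tauLattice τ).ω₁, (tauLattice τ).ω₁_mem_lattice⟩
  simp only [tauLattice] at h1 h2
  set C : ℤ → ℂ := fun n ↦ Real.pi * Complex.cot (Real.pi * (τ / 2 - n * τ)) with hC
  have hper : ∀ w : ℂ, Complex.cot (Real.pi * (w + 1)) = Complex.cot (Real.pi * w) := fun w ↦ by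
    rw [mul_add, mul_one, Complex.cot, Complex.cot, Complex.cos_add_pi, Complex.sin_add_pi,
      neg_div_neg_eq]
  have hodd : ∀ w : ℂ, Complex.cot (-w) = -Complex.cot w := fun w ↦ by
    rw [Complex.cot, Complex.cot, Complex.cos_neg, Complex.sin_neg, div_neg]
  -- For `l = 1` the cotangents cancel by periodicity, so `η₂` is the row-wise Eisenstein sum. In
  -- `η₁ - τ η₂` that sum disappears and a telescoping cotangent series remains.
  have h1' : HasSum (fun n : ℤ ↦ ∑' m : ℤ, 1 / ((n : ℂ) * τ + m) ^ 2) η₂ := by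
    refine h1.congr_fun fun n ↦ ?_
    rw [show (τ : ℂ) / 2 + 1 - n * τ = (τ / 2 - n * τ) + 1 by ring, hper]
    ring
  have h3 : HasSum (fun n : ℤ ↦ C (n - 1) - C n) (η₁ - τ * η₂) := by
    refine (h2.sub (h1'.mul_left (τ : ℂ))).congr_fun fun n ↦ ?_
    simp only [hC]
    rw [show (τ : ℂ) / 2 + τ - n * τ = τ / 2 - ((n - 1 : ℤ) : ℂ) * τ by push_cast; ring]
    ring
  have h4 := h3.nat_add_neg_add_one.tendsto_sum_nat
  have h5 : ∀ K : ℕ, ∑ n ∈ Finset.range K, ((C ((n : ℤ) - 1) - C n) +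
      (C (-((n : ℤ) + 1) - 1) - C (-((n : ℤ) + 1)))) = C (-(K : ℤ) - 1) - C ((K : ℤ) - 1) := by
    intro K
    induction K with
    | zero => simp
    | succ K ih =>
      rw [Finset.sum_range_succ, ih]
      push_cast
      rw [show -(K : ℤ) - 1 = -((K : ℤ) + 1) by ring, show (K : ℤ) + 1 - 1 = K by ring]
      ring
  simp_rw [h5] at h4
  -- The end terms are `π cot` at `π(K + 3/2)τ` and at `-π(K - 3/2)τ`, with limits `-πi` and `πi`.
  have h6 : Tendsto (fun K : ℕ ↦ C (-(K : ℤ) - 1) - C ((K : ℤ) - 1)) atTop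
      (𝓝 (Real.pi * (-Complex.I) - -(Real.pi * (-Complex.I)))) := by
    refine Tendsto.sub ?_ ?_
    · refine ((tendsto_cot_atTop τ (3 / 2)).const_mul (Real.pi : ℂ)).congr fun K ↦ ?_
      simp only [hC]
      congr 3
      push_cast
      ring
    · refine ((tendsto_cot_atTop τ (-3 / 2)).const_mul (Real.pi : ℂ)).neg.congr fun K ↦ ?_
      simp only [hC]
      rw [← mul_neg, ← hodd]
      congr 2
      push_cast
      ring
  have := tendsto_nhds_unique h4 h6
  linear_combination this

/-! ### Behaviour of the normalized form under `z ↦ z + τ` -/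

lemma weierstrassEta_tau (τ : ℍ) : weierstrassEta (tauLattice τ) τ =
    quasiPeriod (tauLattice τ) ⟨(tauLattice τ).ω₁, (tauLattice τ).ω₁_mem_lattice⟩ := by
  have h : (tauLattice τ).basis.repr (τ : ℂ) = Finsupp.single 0 1 := by
    rw [show (τ : ℂ) = (tauLattice τ).basis 0 by simp [tauLattice], Module.Basis.repr_self]
  simp [weierstrassEta, h]

lemma weierstrassEta_one (τ : ℍ) : weierstrassEta (tauLattice τ) 1 =
    quasiPeriod (tauLattice τ) ⟨(tauLattice τ).ω₂, (tauLattice τ).ω₂_mem_lattice⟩ := by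
  have h : (tauLattice τ).basis.repr (1 : ℂ) = Finsupp.single 1 1 := by
    rw [show (1 : ℂ) = (tauLattice τ).basis 1 by simp [tauLattice], Module.Basis.repr_self]
  simp [weierstrassEta, h]

lemma psi_tau (τ : ℍ) : psi (tauLattice τ) τ = -1 := by
  refine if_pos ⟨(tauLattice τ).ω₁_mem_lattice, ?_⟩
  rintro ⟨l, hl, e⟩
  refine (tauLattice τ).ω₁_div_two_notMem_lattice ?_
  rwa [show (tauLattice τ).ω₁ / 2 = l by rw [show (tauLattice τ).ω₁ = τ from rfl, e]; ring]

/-- By the Legendre relation `ρ(τ, z + τ) = ρ(τ, z) exp(η(τ)(z + τ/2)) ζ`. The exponential cancels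
the one in `slashX`, and the sign is `ψ(τ) = -1`. -/
lemma rho_zpow_mul_add_tau {k : ℤ} {φ : ℍ × ℂ → ℂ} (hφ : slashX k 1 0 φ = φ) (τ : ℍ) (z : ℂ) :
    rho (τ, z + τ) ^ k * φ (τ, z + τ) =
      (-Complex.exp (2 * Real.pi * Complex.I * z)) ^ k * (rho (τ, z) ^ k * φ (τ, z)) := by
  have h := congrFun hφ (τ, z)
  simp only [slashX, Complex.ofReal_one, one_mul, Complex.ofReal_zero, add_zero, psi_tau] at h
  rw [← h, ← mul_assoc, ← mul_assoc, ← mul_zpow, ← mul_zpow]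
  congr 2
  simp only [rho]
  rw [neg_one_mul, mul_neg, neg_mul, neg_mul, neg_neg, ← Complex.exp_add, ← Complex.exp_add,
    weierstrassEta_tau, legendre_relation, weierstrassEta_one]
  rw [Complex.exp_eq_exp_iff_exists_int]
  refine ⟨0, ?_⟩
  push_cast
  ring

/-! ### Uniqueness of Fourier coefficients -/

lemma integral_exp_two_pi_int (r : ℤ) :
    ∫ x in (0 : ℝ)..1, Complex.exp (2 * Real.pi * Complex.I * r * x) = if r = 0 then 1 else 0 := by
  split_ifs with h
  · simp [h]
  · have hne : 2 * Real.pi * Complex.I * r ≠ 0 := by simp [Real.pi_ne_zero, h]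
    rw [integral_exp_mul_complex hne]
    have : Complex.exp (2 * Real.pi * Complex.I * r) = 1 := by
      rw [Complex.exp_eq_one_iff]
      exact ⟨r, by ring⟩
    simp [this]

/-- Convergence at `x = 0` makes `a` absolutely summable, so the series times `e(-sx)` can be
integrated termwise over a period. -/
lemma eq_zero_of_hasSum_exp_zpow {a : ℤ → ℂ}
    (h : ∀ x : ℝ, HasSum (fun r ↦ a r * Complex.exp (2 * Real.pi * Complex.I * x) ^ r) 0)
    (s : ℤ) : a s = 0 := by
  have ha : Summable fun r ↦ ‖a r‖ := by simpa using (h 0).summable.norm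
  set F : ℤ → ℝ → ℂ := fun r x ↦ a r * Complex.exp (2 * Real.pi * Complex.I * (r - s : ℤ) * x)
    with hF
  have hcont : ∀ r, Continuous (F r) := fun r ↦ by fun_prop
  have hnorm : ∀ r x, ‖F r x‖ = ‖a r‖ := fun r x ↦ by
    rw [hF]
    simp only [norm_mul]
    rw [show 2 * Real.pi * Complex.I * ((r - s : ℤ) : ℂ) * x =
      ((2 * Real.pi * (r - s : ℤ) * x : ℝ) : ℂ) * Complex.I by push_cast; ring,
      Complex.norm_exp_ofReal_mul_I, mul_one]
  have hsum : ∀ x : ℝ, ∑' r, F r x = 0 := fun x ↦ by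
    have := (h x).mul_right (Complex.exp (2 * Real.pi * Complex.I * x) ^ (-s))
    rw [zero_mul] at this
    refine (this.congr_fun fun r ↦ ?_).tsum_eq
    rw [mul_assoc, ← zpow_add₀ (Complex.exp_ne_zero _), ← Complex.exp_int_mul]
    simp only [hF]
    congr 2
    push_cast
    ring
  have key := MeasureTheory.hasSum_integral_of_summable_integral_norm
    (μ := MeasureTheory.volume.restrict (Set.Ioc (0 : ℝ) 1)) (F := F)
    (fun r ↦ ((hcont r).intervalIntegrable 0 1).1) (by simpa [hnorm] using ha)
  simp only [hsum, MeasureTheory.integral_zero] at key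
  have hval : ∀ r, ∫ x in Set.Ioc (0 : ℝ) 1, F r x = if r = s then a s else 0 := fun r ↦ by
    rw [← intervalIntegral.integral_of_le zero_le_one]
    simp only [hF]
    rw [intervalIntegral.integral_const_mul, integral_exp_two_pi_int]
    by_cases hr : r = s
    · simp [hr]
    · simp [hr, sub_ne_zero.mpr hr]
  simp only [hval] at key
  exact (hasSum_ite_eq s (a s)).unique key

lemma eq_zero_of_hasSum_fourier {D : ℤ × ℤ → ℂ}
    (h : ∀ (τ : ℍ) (z : ℂ), HasSum (fun p : ℤ × ℤ ↦ D p *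
      Complex.exp (2 * Real.pi * Complex.I * τ) ^ p.1 *
        Complex.exp (2 * Real.pi * Complex.I * z) ^ p.2) 0) : D = 0 := by
  have h1 : ∀ (r : ℤ) (τ : ℍ),
      HasSum (fun n : ℤ ↦ D (n, r) * Complex.exp (2 * Real.pi * Complex.I * τ) ^ n) 0 := by
    intro r τ
    have hswap : ∀ z : ℂ, HasSum (fun p : ℤ × ℤ ↦ D (p.2, p.1) *
        Complex.exp (2 * Real.pi * Complex.I * τ) ^ p.2 *
          Complex.exp (2 * Real.pi * Complex.I * z) ^ p.1) 0 := fun z ↦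
      ((Equiv.prodComm ℤ ℤ).hasSum_iff.mpr (h τ z)).congr_fun fun p ↦ by
        simp only [Function.comp_apply, Equiv.prodComm_apply, Prod.fst_swap, Prod.snd_swap]
        rfl
    generalize Complex.exp (2 * Real.pi * Complex.I * τ) = q at hswap ⊢
    have hsumm : ∀ r : ℤ, Summable fun n : ℤ ↦ D (n, r) * q ^ n := fun r ↦ by
      have h0 := (hswap 0).summable.prod_factor r
      simp only [mul_zero, Complex.exp_zero, one_zpow, mul_one] at h0
      exact h0
    have h2 : ∑' n : ℤ, D (n, r) * q ^ n = 0 := by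
      refine eq_zero_of_hasSum_exp_zpow (a := fun r ↦ ∑' n : ℤ, D (n, r) * q ^ n) (fun x ↦ ?_) r
      refine HasSum.prod_fiberwise (hswap x) fun s ↦ ?_
      exact (hsumm s).hasSum.mul_right (Complex.exp (2 * Real.pi * Complex.I * x) ^ s)
    rw [← h2]
    exact (hsumm r).hasSum
  ext ⟨n, r⟩
  -- On the line `τ = x + i` the series in `q` is a Fourier series in `x`, with coefficients scaled
  -- by nonzero factors.
  have h2 := eq_zero_of_hasSum_exp_zpow
    (a := fun n ↦ D (n, r) * Complex.exp (2 * Real.pi * Complex.I * Complex.I) ^ n) (fun x ↦ by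
      have hpos : 0 < ((x : ℂ) + Complex.I).im := by simp
      refine (h1 r ⟨x + Complex.I, hpos⟩).congr_fun fun n ↦ ?_
      rw [mul_assoc, ← mul_zpow, ← Complex.exp_add]
      congr 3
      simp only
      ring) n
  simpa [Complex.exp_ne_zero, zpow_ne_zero] using h2

/-- The coefficients of a Fourier development, extended by zero to `ℤ × ℤ`. -/
def extendCoeff (c : ℕ → ℤ → ℂ) (p : ℤ × ℤ) : ℂ := if 0 ≤ p.1 then c p.1.toNat p.2 else 0

lemma extendCoeff_natCast (c : ℕ → ℤ → ℂ) (n : ℕ) (r : ℤ) : extendCoeff c (n, r) = c n r := by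
  simp [extendCoeff]

lemma extendCoeff_of_neg (c : ℕ → ℤ → ℂ) {n : ℤ} (hn : n < 0) (r : ℤ) :
    extendCoeff c (n, r) = 0 := if_neg (by simpa using hn)

lemma hasSum_extendCoeff {c : ℕ → ℤ → ℂ} {τ : ℍ} {z x : ℂ}
    (h : HasSum (fun p : ℕ × ℤ ↦ c p.1 p.2 * Complex.exp (2 * Real.pi * Complex.I * τ) ^ p.1 *
        Complex.exp (2 * Real.pi * Complex.I * z) ^ p.2) x) :
    HasSum (fun p : ℤ × ℤ ↦ extendCoeff c p * Complex.exp (2 * Real.pi * Complex.I * τ) ^ p.1 *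
        Complex.exp (2 * Real.pi * Complex.I * z) ^ p.2) x := by
  have hinj : Function.Injective (Prod.map ((↑) : ℕ → ℤ) (id : ℤ → ℤ)) :=
    Nat.cast_injective.prodMap Function.injective_id
  refine (hinj.hasSum_iff ?_).mp ?_
  · rintro ⟨n, r⟩ hp
    have hn : n < 0 := by
      by_contra! hn
      exact hp ⟨(n.toNat, r), by simp [hn]⟩
    simp [extendCoeff_of_neg c hn]
  · refine h.congr_fun fun p ↦ ?_
    simp only [Function.comp_apply, Prod.map_fst, Prod.map_snd, id, zpow_natCast]
    rw [← extendCoeff_natCast c p.1 p.2]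
    rfl

/-- The symmetry of the Fourier coefficients that reflects the behaviour under `z ↦ z + τ`. -/
lemma extendCoeff_add {c : ℕ → ℤ → ℂ} {h : ℍ × ℂ → ℂ} {k : ℤ}
    (hc : ∀ (τ : ℍ) (z : ℂ),
      HasSum (fun p : ℕ × ℤ ↦ c p.1 p.2 * Complex.exp (2 * Real.pi * Complex.I * τ) ^ p.1 *
        Complex.exp (2 * Real.pi * Complex.I * z) ^ p.2) (h (τ, z)))
    (hh : ∀ (τ : ℍ) (z : ℂ),
      h (τ, z + τ) = (-Complex.exp (2 * Real.pi * Complex.I * z)) ^ k * h (τ, z)) (n r : ℤ) :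
    extendCoeff c (n + r, r - k) = (-1) ^ k * extendCoeff c (n, r) := by
  -- Replacing `z` by `z + τ` turns `q^n ζ^r` into `q^(n + r) ζ^r`, and dividing by `ζ^k` lowers the
  -- exponent of `ζ` by `k`. Extension by zero to `ℤ × ℤ` makes this a bijection of indices.
  let e : ℤ × ℤ ≃ ℤ × ℤ :=
    { toFun := fun p ↦ (p.1 + p.2, p.2 - k)
      invFun := fun p ↦ (p.1 - (p.2 + k), p.2 + k)
      left_inv := fun p ↦ by ext <;> simp
      right_inv := fun p ↦ by ext <;> simp }
  have hD : (fun p ↦ (-1) ^ k * extendCoeff c (e.symm p) - extendCoeff c p) = 0 := by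
    refine eq_zero_of_hasSum_fourier fun τ z ↦ ?_
    set q := Complex.exp (2 * Real.pi * Complex.I * τ) with hq
    set ζ := Complex.exp (2 * Real.pi * Complex.I * z) with hζ
    have hq0 : q ≠ 0 := Complex.exp_ne_zero _
    have hζ0 : ζ ≠ 0 := Complex.exp_ne_zero _
    have h1 := hasSum_extendCoeff (hc τ z)
    have h2 := (hasSum_extendCoeff (hc τ (z + τ))).mul_left ((-1) ^ k * ζ ^ (-k))
    rw [hh τ z, ← mul_assoc] at h2
    have e1 : (-1) ^ k * ζ ^ (-k) * (-ζ) ^ k = 1 := by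
      rw [neg_eq_neg_one_mul ζ, mul_zpow, show (-1 : ℂ) ^ k * ζ ^ (-k) * ((-1) ^ k * ζ ^ k) =
        ((-1) ^ k * (-1) ^ k) * (ζ ^ (-k) * ζ ^ k) by ring, ← mul_zpow, ← zpow_add₀ hζ0]
      simp
    rw [← hζ, e1, one_mul] at h2
    have h3 := (e.symm.hasSum_iff.mpr h2).sub h1
    rw [sub_self] at h3
    refine h3.congr_fun fun p ↦ ?_
    simp only [Function.comp_apply]
    have e2 : Complex.exp (2 * Real.pi * Complex.I * (z + τ)) = ζ * q := by
      rw [hζ, hq, ← Complex.exp_add]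
      ring_nf
    rw [e2, mul_zpow]
    change _ = (-1) ^ k * ζ ^ (-k) * (extendCoeff c (e.symm p) * q ^ (p.1 - (p.2 + k)) *
      (ζ ^ (p.2 + k) * q ^ (p.2 + k))) - _
    have e3 : q ^ (p.1 - (p.2 + k)) * q ^ (p.2 + k) = q ^ p.1 := by
      rw [← zpow_add₀ hq0, sub_add_cancel]
    have e4 : ζ ^ (-k) * ζ ^ (p.2 + k) = ζ ^ p.2 := by
      rw [← zpow_add₀ hζ0]
      ring_nf
    rw [← e3, ← e4]
    ring
  have := congrFun hD (e (n, r))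
  simp only [Equiv.symm_apply_apply, Pi.zero_apply] at this
  exact (sub_eq_zero.mp this).symm

/-! ### Functions on the upper half-plane given by power series in `q` -/

lemma eq_zero_of_hasSum_exp_pow {a : ℕ → ℂ}
    (h : ∀ τ : ℍ, HasSum (fun n ↦ a n * Complex.exp (2 * Real.pi * Complex.I * τ) ^ n) 0)
    (n : ℕ) : a n = 0 := by
  have hD : extendCoeff (fun n r ↦ if r = 0 then a n else 0) = 0 := by
    refine eq_zero_of_hasSum_fourier fun τ z ↦ hasSum_extendCoeff ?_
    have hinj : Function.Injective fun n : ℕ ↦ (n, (0 : ℤ)) := fun a b h ↦ congrArg Prod.fst h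
    refine (hinj.hasSum_iff ?_).mp ?_
    · rintro ⟨n, r⟩ hp
      have hr : r ≠ 0 := by
        rintro rfl
        exact hp ⟨n, rfl⟩
      simp [hr]
    · refine (h τ).congr_fun fun n ↦ ?_
      simp
  simpa [hD] using (extendCoeff_natCast (fun n r ↦ if r = 0 then a n else 0) n 0).symm

lemma norm_exp_two_pi_I_mul (w : ℂ) :
    ‖Complex.exp (2 * Real.pi * Complex.I * w)‖ = Real.exp (-(2 * Real.pi * w.im)) := by
  rw [Complex.norm_exp]
  simp

section QSeries

variable {a : ℕ → ℂ} {f : ℍ → ℂ}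

lemma summable_norm_mul_exp_pow
    (h : ∀ τ : ℍ, HasSum (fun n ↦ a n * Complex.exp (2 * Real.pi * Complex.I * τ) ^ n) (f τ))
    {y : ℝ} (hy : 0 < y) : Summable fun n ↦ ‖a n‖ * Real.exp (-(2 * Real.pi * y)) ^ n := by
  have him : 0 < (Complex.I * y).im := by simpa using hy
  refine (h ⟨Complex.I * y, him⟩).summable.norm.congr fun n ↦ ?_
  rw [norm_mul, norm_pow, norm_exp_two_pi_I_mul]
  simp

lemma norm_mul_exp_pow_le {y : ℝ} {w : ℂ} (hw : y ≤ w.im) (n : ℕ) :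
    ‖a n * Complex.exp (2 * Real.pi * Complex.I * w) ^ n‖ ≤
      ‖a n‖ * Real.exp (-(2 * Real.pi * y)) ^ n := by
  rw [norm_mul, norm_pow, norm_exp_two_pi_I_mul]
  gcongr

lemma mdifferentiable_of_hasSum_exp_pow
    (h : ∀ τ : ℍ, HasSum (fun n ↦ a n * Complex.exp (2 * Real.pi * Complex.I * τ) ^ n) (f τ)) :
    MDiff f := by
  rw [UpperHalfPlane.mdifferentiable_iff]
  intro w hw
  have hw' : 0 < w.im := hw
  have hd := Complex.differentiableOn_tsum_of_summable_norm
    (F := fun (n : ℕ) (w : ℂ) ↦ a n * Complex.exp (2 * Real.pi * Complex.I * w) ^ n)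
    (summable_norm_mul_exp_pow h (half_pos hw')) (U := {v : ℂ | w.im / 2 < v.im})
    (fun n ↦ by fun_prop) (isOpen_lt continuous_const Complex.continuous_im)
    (fun n v hv ↦ norm_mul_exp_pow_le (le_of_lt hv) n)
  have hU : {v : ℂ | w.im / 2 < v.im} ∈ 𝓝 w :=
    (isOpen_lt continuous_const Complex.continuous_im).mem_nhds (by
      simp only [Set.mem_ofPred_eq]; linarith)
  refine ((hd.differentiableAt hU).congr_of_eventuallyEq ?_).differentiableWithinAt
  filter_upwards [hU] with v hv
  have hv0 : 0 < v.im := lt_trans (half_pos hw') hv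
  have := (h ⟨v, hv0⟩).tsum_eq
  simp only [Function.comp_apply, UpperHalfPlane.ofComplex_apply_of_im_pos hv0]
  rw [← this]

lemma isBoundedAtImInfty_of_hasSum_exp_pow
    (h : ∀ τ : ℍ, HasSum (fun n ↦ a n * Complex.exp (2 * Real.pi * Complex.I * τ) ^ n) (f τ)) :
    IsBoundedAtImInfty f := by
  rw [UpperHalfPlane.isBoundedAtImInfty_iff]
  refine ⟨∑' n, ‖a n‖ * Real.exp (-(2 * Real.pi * 1)) ^ n, 1, fun τ hτ ↦ ?_⟩
  rw [← (h τ).tsum_eq]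
  exact tsum_of_norm_bounded (summable_norm_mul_exp_pow h one_pos).hasSum
    fun n ↦ norm_mul_exp_pow_le hτ n

/-- The level one modular form attached to a power series in `q` with the right behaviour under
`SL(2, ℤ)`. -/
def modularFormOfHasSum (w : ℤ)
    (h : ∀ τ : ℍ, HasSum (fun n ↦ a n * Complex.exp (2 * Real.pi * Complex.I * τ) ^ n) (f τ))
    (hf : ∀ (M : SL(2, ℤ)) (τ : ℍ), f (M • τ) * denom M τ ^ (-w) = f τ) :
    ModularForm 𝒮ℒ w where
  toFun := f
  slash_action_eq' := by
    rintro _ ⟨M, rfl⟩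
    ext τ
    exact (ModularForm.SL_slash_apply ..).trans (hf M τ)
  holo' := mdifferentiable_of_hasSum_exp_pow h
  bdd_at_cusps' hc := by
    rw [OnePoint.isBoundedAt_iff_forall_SL2Z hc]
    intro M _
    -- Invariance under all of `SL(2, ℤ)` reduces every cusp to `i∞`.
    have : f ∣[w] M = f := by
      ext τ
      exact (ModularForm.SL_slash_apply ..).trans (hf M τ)
    rw [this]
    exact isBoundedAtImInfty_of_hasSum_exp_pow h

end QSeries

/-! ### The Taylor expansion of a Fourier development at `z = 0` -/

/-- The `n`-th coefficient of the `j`-th Taylor coefficient at `z = 0` of a Fourier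
development. -/
def moment (c : ℕ → ℤ → ℂ) (j n : ℕ) : ℂ :=
  ∑' r : ℤ, c n r * ((2 * Real.pi * Complex.I * r) ^ j / j.factorial)

lemma exp_abs_le_add (r : ℤ) (x : ℝ) :
    Real.exp (|(r : ℝ)| * x) ≤ Real.exp x ^ r + Real.exp (-x) ^ r := by
  rw [← Real.rpow_intCast, ← Real.rpow_intCast, ← Real.exp_mul, ← Real.exp_mul]
  rcases abs_cases (r : ℝ) with ⟨h, _⟩ | ⟨h, _⟩ <;> rw [h]
  · rw [mul_comm]
    exact le_add_of_nonneg_right (Real.exp_nonneg _)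
  · rw [show -(r : ℝ) * x = -x * r by ring]
    exact le_add_of_nonneg_left (Real.exp_nonneg _)

section Taylor

variable {c : ℕ → ℤ → ℂ} {h : ℍ × ℂ → ℂ}

/-- The norms of the exponential series of `e(rz)` add up to `exp(2π|r|‖z‖)`. This is dominated by
the Fourier terms at `∓i‖z‖` together, by `exp_abs_le_add`. -/
lemma summable_taylor
    (hc : ∀ (τ : ℍ) (z : ℂ),
      HasSum (fun p : ℕ × ℤ ↦ c p.1 p.2 * Complex.exp (2 * Real.pi * Complex.I * τ) ^ p.1 *
        Complex.exp (2 * Real.pi * Complex.I * z) ^ p.2) (h (τ, z))) (τ : ℍ) (z : ℂ) :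
    Summable fun p : (ℕ × ℤ) × ℕ ↦
      c p.1.1 p.1.2 * Complex.exp (2 * Real.pi * Complex.I * τ) ^ p.1.1 *
        ((2 * Real.pi * Complex.I * p.1.2 * z) ^ p.2 / p.2.factorial) := by
  refine Summable.of_norm ?_
  set q := Complex.exp (2 * Real.pi * Complex.I * τ)
  have hexp : ∀ r : ℤ, HasSum
      (fun j : ℕ ↦ ‖(2 * Real.pi * Complex.I * r * z) ^ j / (j.factorial : ℂ)‖)
      (Real.exp (|(r : ℝ)| * (2 * Real.pi * ‖z‖))) := fun r ↦ by
    have h1 := NormedSpace.expSeries_div_hasSum_exp (|(r : ℝ)| * (2 * Real.pi * ‖z‖))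
    rw [← Real.exp_eq_exp_ℝ] at h1
    refine h1.congr_fun fun j ↦ ?_
    rw [norm_div, norm_pow]
    simp [abs_of_pos Real.pi_pos]
    ring
  rw [summable_prod_of_nonneg fun _ ↦ norm_nonneg _]
  simp only [norm_mul _ (_ / _)]
  refine ⟨fun p ↦ ((hexp p.2).mul_left _).summable, ?_⟩
  simp only [((hexp _).mul_left _).tsum_eq]
  have h1 := (hc τ (-Complex.I * ‖z‖)).summable.norm
  have h2 := (hc τ (Complex.I * ‖z‖)).summable.norm
  refine Summable.of_nonneg_of_le (fun p ↦ by positivity) (fun p ↦ ?_) (h1.add h2)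
  rw [norm_mul _ (_ ^ p.2), norm_mul _ (_ ^ p.2), ← mul_add]
  gcongr
  rw [norm_zpow, norm_zpow, norm_exp_two_pi_I_mul, norm_exp_two_pi_I_mul]
  simpa using exp_abs_le_add p.2 (2 * Real.pi * ‖z‖)

/-- Absolute summability lets the sum over `(n, r, j)` be taken in two orders: over `j` first it
gives back `h`, over `(n, r)` first it gives a power series in `z`. -/
lemma exists_taylor
    (hc : ∀ (τ : ℍ) (z : ℂ),
      HasSum (fun p : ℕ × ℤ ↦ c p.1 p.2 * Complex.exp (2 * Real.pi * Complex.I * τ) ^ p.1 *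
        Complex.exp (2 * Real.pi * Complex.I * z) ^ p.2) (h (τ, z))) :
    ∃ B : ℕ → ℍ → ℂ,
      (∀ (j : ℕ) (τ : ℍ), HasSum (fun n ↦ moment c j n * Complex.exp (2 * Real.pi * Complex.I * τ) ^ n)
        (B j τ)) ∧
      ∀ (τ : ℍ) (z : ℂ), HasSum (fun j ↦ B j τ * z ^ j) (h (τ, z)) := by
  have hsw : ∀ (τ : ℍ) (z : ℂ), Summable fun p : ℕ × (ℕ × ℤ) ↦
      c p.2.1 p.2.2 * Complex.exp (2 * Real.pi * Complex.I * τ) ^ p.2.1 *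
        ((2 * Real.pi * Complex.I * p.2.2 * z) ^ p.1 / p.1.factorial) := fun τ z ↦
    (Equiv.prodComm ℕ (ℕ × ℤ)).summable_iff.mpr (summable_taylor hc τ z)
  have hrow : ∀ (j : ℕ) (τ : ℍ), Summable fun p : ℕ × ℤ ↦
      c p.1 p.2 * Complex.exp (2 * Real.pi * Complex.I * τ) ^ p.1 *
        ((2 * Real.pi * Complex.I * p.2) ^ j / j.factorial) := fun j τ ↦ by
    have h0 := (hsw τ 1).prod_factor j
    simp only [mul_one] at h0
    exact h0
  refine ⟨fun j τ ↦ ∑' p : ℕ × ℤ,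
    c p.1 p.2 * Complex.exp (2 * Real.pi * Complex.I * τ) ^ p.1 *
        ((2 * Real.pi * Complex.I * p.2) ^ j / j.factorial), fun j τ ↦ ?_, fun τ z ↦ ?_⟩
  · refine (hrow j τ).hasSum.prod_fiberwise fun n ↦ ?_
    have hq : Complex.exp (2 * Real.pi * Complex.I * τ) ^ n ≠ 0 :=
      pow_ne_zero _ (Complex.exp_ne_zero _)
    have h1 : Summable fun r : ℤ ↦ c n r * ((2 * Real.pi * Complex.I * r) ^ j / j.factorial) := by
      refine (((hrow j τ).prod_factor n).mul_right
        (Complex.exp (2 * Real.pi * Complex.I * τ) ^ n)⁻¹).congr fun r ↦ ?_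
      simp only
      field_simp
    refine (h1.hasSum.mul_right (Complex.exp (2 * Real.pi * Complex.I * τ) ^ n)).congr_fun
      fun r ↦ ?_
    ring
  · have h1 : ∑' p : (ℕ × ℤ) × ℕ,
        c p.1.1 p.1.2 * Complex.exp (2 * Real.pi * Complex.I * τ) ^ p.1.1 *
          ((2 * Real.pi * Complex.I * p.1.2 * z) ^ p.2 / p.2.factorial) = h (τ, z) := by
      refine ((summable_taylor hc τ z).hasSum.prod_fiberwise (g := fun p : ℕ × ℤ ↦
        c p.1 p.2 * Complex.exp (2 * Real.pi * Complex.I * τ) ^ p.1 *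
          Complex.exp (2 * Real.pi * Complex.I * z) ^ p.2) fun p ↦ ?_).unique (hc τ z)
      have h1 := NormedSpace.expSeries_div_hasSum_exp (2 * Real.pi * Complex.I * p.2 * z)
      rw [← Complex.exp_eq_exp_ℂ] at h1
      rw [← Complex.exp_int_mul, show (p.2 : ℂ) * (2 * Real.pi * Complex.I * z) =
        2 * Real.pi * Complex.I * p.2 * z by ring]
      exact h1.mul_left (c p.1 p.2 * Complex.exp (2 * Real.pi * Complex.I * τ) ^ p.1)
    rw [← h1, ← (Equiv.prodComm ℕ (ℕ × ℤ)).tsum_eq]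
    refine (hsw τ z).hasSum.prod_fiberwise fun j ↦ ?_
    refine ((hrow j τ).hasSum.mul_right (z ^ j)).congr_fun fun p ↦ ?_
    rw [mul_pow]
    ring

end Taylor

lemma tendsto_div_pow_of_hasSum {b : ℕ → ℂ} {g : ℂ → ℂ}
    (hg : ∀ z, HasSum (fun j ↦ b j * z ^ j) (g z)) {J : ℕ} (hb : ∀ j < J, b j = 0) :
    Tendsto (fun z ↦ g z / z ^ J) (𝓝[≠] 0) (𝓝 (b J)) := by
  have hsum : Summable fun j ↦ ‖b (j + J)‖ := by
    simpa using ((summable_nat_add_iff J).mpr (hg 1).summable.norm)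
  have hcont : ContinuousOn (fun z ↦ ∑' j, b (j + J) * z ^ j) (Metric.ball 0 1) := by
    refine continuousOn_tsum (fun j ↦ by fun_prop) hsum fun j z hz ↦ ?_
    rw [norm_mul, norm_pow]
    have : ‖z‖ ≤ 1 := (mem_ball_zero_iff.mp hz).le
    exact mul_le_of_le_one_right (norm_nonneg _) (pow_le_one₀ (norm_nonneg _) this)
  have h0 := (hcont.continuousAt (Metric.ball_mem_nhds 0 one_pos)).tendsto
  have e0 : ∑' j, b (j + J) * (0 : ℂ) ^ j = b J := by
    rw [tsum_eq_single 0 fun j hj ↦ by simp [hj]]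
    simp
  rw [e0] at h0
  refine (h0.mono_left nhdsWithin_le_nhds).congr' ?_
  filter_upwards [self_mem_nhdsWithin] with z hz
  have hzJ : z ^ J ≠ 0 := pow_ne_zero _ hz
  rw [eq_div_iff hzJ, ← tsum_mul_right, ← (hg z).tsum_eq,
    ← (hg z).summable.sum_add_tsum_nat_add J, Finset.sum_eq_zero fun j hj ↦ by
      rw [hb j (Finset.mem_range.mp hj), zero_mul], zero_add]
  exact tsum_congr fun j ↦ by ring

/-! ### Vanishing of a Fourier development with vanishing moments -/

lemma coeff_eq_zero_of_moment_eq_zero {c : ℕ → ℤ → ℂ} {N : ℕ} {ε : ℂ} (hε : ε ≠ 0)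
    (hsym : ∀ n r : ℤ, extendCoeff c (n + r, r + N) = ε * extendCoeff c (n, r))
    (hmom : ∀ j ≤ N, ∀ n, moment c j n = 0) (n : ℕ) : ∀ r : ℤ, c n r = 0 := by
  induction n using Nat.strong_induction_on with
  | _ n ih =>
    have hlt : ∀ m r : ℤ, m < n → extendCoeff c (m, r) = 0 := fun m r hm ↦ by
      rcases lt_or_ge m 0 with h | h
      · exact extendCoeff_of_neg c h r
      · lift m to ℕ using h
        rw [extendCoeff_natCast]
        exact ih m (by exact_mod_cast hm) r
    have hneg : ∀ r : ℤ, r < 0 → c n r = 0 := fun r hr ↦ by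
      have h1 := hsym n r
      rw [hlt _ _ (by omega), extendCoeff_natCast] at h1
      exact (mul_eq_zero.mp h1.symm).resolve_left hε
    have hbig : ∀ r : ℤ, (N : ℤ) < r → c n r = 0 := fun r hr ↦ by
      -- The symmetry carries this index, which lies in an earlier row, to `(n, r)`.
      have h1 := hsym (n - (r - N)) (r - N)
      rw [hlt (n - (r - N)) _ (by omega), mul_zero, sub_add_cancel, sub_add_cancel,
        extendCoeff_natCast] at h1
      exact h1
    have hv : (fun i : Fin (N + 1) ↦ c n ((i : ℕ) : ℤ)) = 0 := by
      -- Vandermonde: the moments of index `0, …, N` are, up to factorials, power sums at the `N +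
      -- 1` distinct nodes `2πi · r`, `0 ≤ r ≤ N`.
      refine Matrix.eq_zero_of_forall_pow_sum_mul_pow_eq_zero
        (f := fun i : Fin (N + 1) ↦ 2 * Real.pi * Complex.I * ((i : ℕ) : ℂ)) ?_ fun j ↦ ?_
      · intro a b hab
        have h2 : (2 * Real.pi * Complex.I : ℂ) ≠ 0 := by simp [Real.pi_ne_zero]
        have h3 : ((a : ℕ) : ℂ) = ((b : ℕ) : ℂ) := mul_left_cancel₀ h2 hab
        exact Fin.ext (by exact_mod_cast h3)
      · have h1 := hmom j (by omega) n
        have hinj : Function.Injective fun i : Fin (N + 1) ↦ ((i : ℕ) : ℤ) := fun a b hab ↦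
          Fin.ext (Nat.cast_injective (R := ℤ) hab)
        rw [moment, ← hinj.tsum_eq, tsum_fintype] at h1
        · have hfac : ((j : ℕ).factorial : ℂ) ≠ 0 := by exact_mod_cast (j : ℕ).factorial_ne_zero
          simp only [Int.cast_natCast, ← mul_div_assoc] at h1
          rw [← Finset.sum_div, div_eq_zero_iff] at h1
          exact h1.resolve_right hfac
        · intro r hr
          have hr' : c n r ≠ 0 := fun h ↦ hr (by simp [h])
          have h3 : 0 ≤ r := not_lt.mp fun h ↦ hr' (hneg r h)
          have h4 : r ≤ N := not_lt.mp fun h ↦ hr' (hbig r h)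
          exact ⟨⟨r.toNat, by omega⟩, by simp [h3]⟩
    intro r
    rcases lt_or_ge r 0 with h | h
    · exact hneg r h
    rcases lt_or_ge (N : ℤ) r with h' | h'
    · exact hbig r h'
    · lift r to ℕ using h
      exact congrFun hv ⟨r, by omega⟩

/-! ### Modified Jacobi forms of negative weight -/

section NegativeWeight

variable {k : ℤ} {φ : ℍ × ℂ → ℂ}

lemma tendsto_div_pow_of_taylor {B : ℕ → ℍ → ℂ}
    (hB : ∀ τ z, HasSum (fun j ↦ B j τ * z ^ j) (rho (τ, z) ^ k * φ (τ, z))) {J : ℕ}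
    (hJ : ∀ j < J, B j = 0) (τ : ℍ) :
    Tendsto (fun z ↦ φ (τ, z) / z ^ J) (𝓝[≠] 0) (𝓝 (B J τ)) := by
  have h1 := tendsto_div_pow_of_hasSum (hB τ) (J := J) fun j hj ↦ by simp [hJ j hj]
  have hrho : ∀ z, rho (τ, z) ≠ 0 := fun z ↦ Complex.exp_ne_zero _
  have h2 : Tendsto (fun z ↦ rho (τ, z) ^ (-k)) (𝓝[≠] 0) (𝓝 1) := by
    have hc : Continuous fun z ↦ rho (τ, z) := by
      simp only [rho]
      fun_prop
    have h3 := ((hc.zpow₀ (-k) fun z ↦ Or.inl (hrho z)).tendsto 0).mono_left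
      (nhdsWithin_le_nhds (s := {0}ᶜ))
    simpa [rho] using h3
  have h4 := h2.mul h1
  rw [one_mul] at h4
  refine h4.congr fun z ↦ ?_
  rw [mul_div_assoc, ← mul_assoc, ← zpow_add₀ (hrho z)]
  simp

lemma smul_mul_denom_of_tendsto {J : ℕ} {b : ℍ → ℂ} (hφ : ∀ M : SL(2, ℤ), slashM k M φ = φ)
    (hb : ∀ τ, Tendsto (fun z ↦ φ (τ, z) / z ^ J) (𝓝[≠] 0) (𝓝 (b τ)))
    (M : SL(2, ℤ)) (τ : ℍ) : b (M • τ) * denom M τ ^ (-(k + J)) = b τ := by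
  set d := denom M τ with hd
  have hd0 : d ≠ 0 := denom_ne_zero _ _
  have hlim : Tendsto (fun z : ℂ ↦ z / d) (𝓝[≠] 0) (𝓝[≠] 0) := by
    refine tendsto_nhdsWithin_iff.mpr ⟨?_, ?_⟩
    · have : Continuous fun z : ℂ ↦ z / d := by fun_prop
      simpa using (this.tendsto 0).mono_left (nhdsWithin_le_nhds (s := {0}ᶜ))
    · filter_upwards [self_mem_nhdsWithin] with z hz
      exact div_ne_zero hz hd0
  -- Evaluate the limit at `M • τ` along `z / d`: the slash action contributes `d^k` and the
  -- denominator `(z / d)^J` contributes `d^J`, which gives weight `k + J`.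
  refine tendsto_nhds_unique ((((hb (M • τ)).comp hlim).mul_const (d ^ (-(k + J)))).congr' ?_)
    (hb τ)
  filter_upwards [self_mem_nhdsWithin] with z hz
  have hz0 : z ≠ 0 := hz
  have h1 := congrFun (hφ M) (τ, z)
  have hden : (M 1 0 : ℂ) * τ + (M 1 1 : ℂ) = d := by
    rw [hd]
    simp [denom]
  simp only [slashM, hden] at h1
  rw [← h1]
  simp only [Function.comp_apply]
  rw [neg_add, zpow_add₀ hd0, div_pow, zpow_neg d J, zpow_natCast]
  field_simp

/-- The first Taylor coefficients of a modified Jacobi form of negative weight `k` vanish, and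
the coefficient of index `-k` is constant. -/
lemma IsModifiedJacobiForm.exists_tendsto {N : ℕ} (hφ : IsModifiedJacobiForm (-N) ⊤ φ) :
    ∃ b : ℂ, (∀ τ, Tendsto (fun z ↦ φ (τ, z) / z ^ N) (𝓝[≠] 0) (𝓝 b)) ∧ (b = 0 → φ = 0) := by
  obtain ⟨r₀, -, c, -, hc⟩ := hφ.fourier 1
  have hinv : ∀ M : SL(2, ℤ), slashM (-N) M φ = φ := fun M ↦ hφ.slashM_eq M trivial
  simp only [hinv] at hc
  obtain ⟨B, hBq, hBz⟩ := exists_taylor (h := fun p ↦ rho p ^ (-N : ℤ) * φ p) hc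
  have hmod : ∀ J, (∀ j < J, B j = 0) → ∀ (M : SL(2, ℤ)) (τ : ℍ),
      B J (M • τ) * denom M τ ^ (-(-N + J : ℤ)) = B J τ := fun J hJ ↦
    smul_mul_denom_of_tendsto hinv (tendsto_div_pow_of_taylor hBz hJ)
  -- Once all earlier coefficients vanish, `B J` is a modular form of negative weight `J - N`.
  have hlow : ∀ J < N, B J = 0 := by
    intro J
    induction J using Nat.strong_induction_on with
    | _ J ih =>
      intro hJ
      exact ModularFormClass.levelOne_neg_weight_eq_zero (k := -N + J) (by omega)
        (modularFormOfHasSum _ (hBq J) (hmod J fun j hj ↦ ih j hj (hj.trans hJ)))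
  obtain ⟨b, hb⟩ : ∃ b, B N = Function.const ℍ b :=
    ModularFormClass.levelOne_weight_zero_const
      (modularFormOfHasSum 0 (hBq N) (by simpa using hmod N hlow))
  refine ⟨b, fun τ ↦ by simpa [hb] using tendsto_div_pow_of_taylor hBz hlow τ, fun hb0 ↦ ?_⟩
  have hB0 : ∀ j ≤ N, B j = 0 := fun j hj ↦ by
    rcases hj.lt_or_eq with h | rfl
    · exact hlow j h
    · rw [hb, hb0]
      rfl
  have hslash : slashX (-N) 1 0 φ = φ := by simpa using hφ.slashX_eq 1 0
  have hcoeff := coeff_eq_zero_of_moment_eq_zero (c := c) (N := N) (ε := (-1) ^ (-N : ℤ))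
    (zpow_ne_zero _ (by simp))
    (fun n r ↦ by
      simpa using extendCoeff_add (k := -N) (h := fun p ↦ rho p ^ (-N : ℤ) * φ p) hc
        (rho_zpow_mul_add_tau hslash) n r)
    fun j hj ↦ eq_zero_of_hasSum_exp_pow fun τ ↦ by simpa [hB0 j hj] using hBq j τ
  ext ⟨τ, z⟩
  have h0 := hc τ z
  simp only [hcoeff, zero_mul] at h0
  exact (mul_eq_zero.mp (h0.unique hasSum_zero)).resolve_left
    (zpow_ne_zero _ (Complex.exp_ne_zero _))

/-- The space of modified Jacobi forms of negative weight on `SL(2, ℤ)` has dimension at most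
one. -/
theorem J_le_span_singleton (N : ℕ) : ∃ v, J (-N) ⊤ ≤ ℂ ∙ v := by
  by_cases hex : ∃ v ∈ J (-N) ⊤, v ≠ 0
  · obtain ⟨v, hv, hv0⟩ := hex
    obtain ⟨b, hb, hb0⟩ := IsModifiedJacobiForm.exists_tendsto hv
    have hbne : b ≠ 0 := fun h ↦ hv0 (hb0 h)
    refine ⟨v, fun φ hφ ↦ ?_⟩
    obtain ⟨a, ha, -⟩ := IsModifiedJacobiForm.exists_tendsto hφ
    -- The multiple of `v` is chosen so that the leading constant `a - (a / b) b` of the difference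
    -- is zero. It may be computed at any single point of `ℍ`.
    obtain ⟨e, he, he0⟩ := IsModifiedJacobiForm.exists_tendsto
      ((J (-N) ⊤).sub_mem hφ ((J (-N) ⊤).smul_mem (a / b) hv))
    have he' : e = 0 := by
      refine (tendsto_nhds_unique (he I) ?_)
      have h1 := (ha I).sub ((hb I).const_mul (a / b))
      rw [div_mul_cancel₀ _ hbne, sub_self] at h1
      refine h1.congr fun z ↦ ?_
      simp only [Pi.sub_apply, Pi.smul_apply, smul_eq_mul]
      ring
    rw [sub_eq_zero.mp (he0 he')]
    exact Submodule.smul_mem _ _ (Submodule.mem_span_singleton_self v)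
  · push Not at hex
    exact ⟨0, fun φ hφ ↦ by simp [hex φ hφ]⟩

end NegativeWeight

end ModifiedJacobi

end

theorem theorem4p6 (k m : ℤ) (hk : k < 0) (hm : 0 < m) :
    FiniteDimensional ℂ (ModifiedJacobi.Jm k m) := by
  obtain ⟨N, rfl⟩ : ∃ N : ℕ, k = -N := ⟨k.natAbs, by omega⟩
  obtain ⟨v, hv⟩ := ModifiedJacobi.J_le_span_singleton N
  have hle : ModifiedJacobi.Jm (-N) m ≤ ℂ ∙ v := fun φ hφ ↦ hv hφ.1
  exact Submodule.finiteDimensional_of_le hle
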